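/- Let $\nu$ be a nonzero L\'evy measure of a subordinator, i.e. a measure on $(0,\infty)$ with $0<\nu((0,\infty))\le\infty$ and $\int_{(0,\infty)}\min(1,z)\,\nu(dz)<\infty$. On a probability space, let $M$ be a Poisson random measure on $[0,\infty)\times(0,\infty)$ with intensity $dt\otimes\nu(dz)$, and consider the driftless subordinator and its discretizations $$X_t=\int_{(0,\infty)}z\,M([0,t],dz),\qquad X^{(\epsilon)}_t=\int_{[\epsilon,\infty)}\epsilon\lfloor z/\epsilon\rfloor\,M([0,t],dz),\qquad t\ge0,\ \epsilon\in(0,1]\cap\mathbb{Q},$$ with the exponential functionals $I_{[X]}=\int_0^\infty e^{-X_t}\,dt$ and $I_{[X^{(\epsilon)}]}=\int_0^\infty e^{-X^{(\epsilon)}_t}\,dt$, as random variables with values in $[0,\infty]$. Let $m\in\{0,1,2,\dots\}$. (i) If $\epsilon_0\in(0,1]$ and $\nu([\epsilon_0,\infty))>0$, then $I_{[X^{(\epsilon)}]}<\infty$ almost surely for every rational $\epsilon\in(0,\epsilon_0]$, and the family $\{I_{[X^{(\epsilon)}]}^m:\epsilon\in(0,\epsilon_0]\cap\mathbb{Q}\}$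 is uniformly integrable. In particular, if $\nu([1,\infty))>0$, then $\{I_{[X^{(\epsilon)}]}^m:\epsilon\in(0,1]\cap\mathbb{Q}\}$ is uniformly integrable. (ii) $E\,I_{[X]}^m<\infty$, and $E\,I_{[X^{(\epsilon)}]}^m\to E\,I_{[X]}^m$ as $\epsilon\searrow0$ along the rationals. -/

import Mathlib

open Set Filter Topology MeasureTheory ProbabilityTheory
open scoped NNReal ENNReal

noncomputable section

namespace Subordinators

/-- `ν` is the Lévy measure of a subordinator: it is carried by `(0, ∞)` and
`∫ min(1, z) ν(dz) < ∞`. -/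
structure IsSubordinatorLevyMeasure (ν : Measure ℝ) : Prop where
  measure_Iic_zero : ν (Iic 0) = 0
  lintegral_min_lt_top : ∫⁻ z, ENNReal.ofReal (min 1 z) ∂ν < ∞

/-- `M` is a Poisson random measure with intensity measure `μ`, defined on the probability space
`(Ω, P)`: `M(B)` has the Poisson law of mean `μ(B)` (and is almost surely infinite if
`μ(B) = ∞`), and `M` takes independent values on disjoint sets. -/
structure IsPoissonRandomMeasure {Ω E : Type*} [MeasurableSpace Ω] [MeasurableSpace E]
    (M : Ω → Measure E) (μ : Measure E) (P : Measure Ω) : Prop where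
  measurable : Measurable M
  map_apply : ∀ B : Set E, MeasurableSet B → μ B ≠ ∞ →
    P.map (fun ω => M ω B) = (poissonMeasure (μ B).toNNReal).map (fun n : ℕ => (n : ℝ≥0∞))
  ae_eq_top : ∀ B : Set E, MeasurableSet B → μ B = ∞ → ∀ᵐ ω ∂P, M ω B = ∞
  iIndepFun_apply : ∀ (n : ℕ) (B : Fin n → Set E), (∀ i, MeasurableSet (B i)) →
    Pairwise (fun i j => Disjoint (B i) (B j)) → iIndepFun (fun i ω => M ω (B i)) P

/-- The measure `dt ⊗ ν(dz)` on `[0, ∞) × ℝ`, as a measure on `ℝ × ℝ` (time, jump size). -/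
def jumpIntensity (ν : Measure ℝ) : Measure (ℝ × ℝ) :=
  ((volume : Measure ℝ).restrict (Ici 0)).prod ν

/-- `X_t = ∫_{(0,∞)} z M([0,t], dz)`. -/
def jumpProcess {Ω : Type*} (M : Ω → Measure (ℝ × ℝ)) (t : ℝ) (ω : Ω) : ℝ≥0∞ :=
  ∫⁻ p in Icc 0 t ×ˢ Ioi 0, ENNReal.ofReal p.2 ∂(M ω)

/-- `X^(ε)_t = ∫_{[ε,∞)} ε ⌊z/ε⌋ M([0,t], dz)`. -/
def approxProcess {Ω : Type*} (M : Ω → Measure (ℝ × ℝ)) (ε : ℝ) (t : ℝ) (ω : Ω) : ℝ≥0∞ :=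
  ∫⁻ p in Icc 0 t ×ˢ Ici ε, ENNReal.ofReal (ε * (⌊p.2 / ε⌋ : ℝ)) ∂(M ω)

/-- The exponential functional `∫_0^∞ e^{-X_t} dt` of a `[0, ∞]`-valued process, as an element of
`[0, ∞]` (with `e^{-∞} = 0`). -/
def expFunctional {Ω : Type*} (X : ℝ → Ω → ℝ≥0∞) (ω : Ω) : ℝ≥0∞ :=
  ∫⁻ t in Ici (0 : ℝ), EReal.exp (-(X t ω : EReal))

end Subordinators

end

/-! Everything rests on one dominating variable. If `ε ≤ ε₀`, rounding a jump `z ≥ ε₀` down to a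
multiple of `ε` keeps at least half of it, so both the approximations and the limit process lie
above `Y_t = (ε₀/2) N_t`, where `N_t` counts the jumps of size at least `ε₀`
(`mul_measure_le_approxProcess`). All the exponential functionals are then at most that of `Y`.

The latter has all moments: it is at most `∑ₙ e^{-c Nₙ}` with `c = ε₀/2`, and the Poisson Laplace
transform decays exponentially in `n` (`lintegral_tsum_exp_neg_pow_lt_top`). Domination gives (i).
For (ii), the approximations converge at each time (`tendsto_approxProcess`), and dominated
convergence is applied in `t` for almost every `ω`, then in `ω`. -/

theorem expNeg_antitone : Antitone (fun x : ℝ≥0∞ => EReal.exp (-(x : EReal))) := fun _ _ h =>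
  EReal.exp_monotone (EReal.neg_le_neg_iff.2 (EReal.coe_ennreal_le_coe_ennreal_iff.2 h))

theorem continuous_expNeg : Continuous (fun x : ℝ≥0∞ => EReal.exp (-(x : EReal))) :=
  ENNReal.continuous_exp.comp (continuous_neg.comp continuous_coe_ennreal_ereal)

theorem expNeg_le_one (x : ℝ≥0∞) : EReal.exp (-(x : EReal)) ≤ 1 := by
  rw [EReal.exp_le_one_iff, EReal.neg_le, neg_zero]
  exact EReal.coe_ennreal_nonneg x

theorem expNeg_ofReal {x : ℝ} (hx : 0 ≤ x) :
    EReal.exp (-(ENNReal.ofReal x : EReal)) = ENNReal.ofReal (Real.exp (-x)) := by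
  rw [EReal.coe_ennreal_ofReal, max_eq_left hx, ← EReal.coe_neg, EReal.exp_coe]

/-! ### Riemann sums of decreasing functions. -/

theorem iUnion_Ico_nat_mul {h : ℝ} (hh : 0 < h) :
    (⋃ j : ℕ, Ico (h * j) (h * (j + 1))) = Ici (0 : ℝ) := by
  ext x
  simp only [mem_iUnion, mem_Ico, mem_Ici]
  constructor
  · rintro ⟨j, hj, -⟩
    exact le_trans (by positivity) hj
  · intro hx
    refine ⟨⌊x / h⌋₊, ?_, ?_⟩
    · rw [mul_comm, ← le_div_iff₀ hh]
      exact Nat.floor_le (by positivity)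
    · rw [mul_comm, ← div_lt_iff₀ hh]
      exact Nat.lt_floor_add_one _

theorem pairwise_disjoint_Ico_nat_mul {h : ℝ} (hh : 0 < h) :
    Pairwise (Function.onFun Disjoint (fun j : ℕ => Ico (h * j) (h * ((j : ℝ) + 1)))) := by
  have hm : Monotone (fun j : ℕ => h * (j : ℝ)) := fun a b hab =>
    mul_le_mul_of_nonneg_left (by exact_mod_cast hab) hh.le
  have := hm.pairwise_disjoint_on_Ico_succ
  simpa [Nat.succ_eq_add_one] using this

theorem setLIntegral_Ici_eq_tsum {h : ℝ} (hh : 0 < h) (f : ℝ → ℝ≥0∞) :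
    ∫⁻ t in Ici (0 : ℝ), f t = ∑' j : ℕ, ∫⁻ t in Ico (h * j) (h * (j + 1)), f t := by
  rw [← iUnion_Ico_nat_mul hh]
  exact lintegral_iUnion (fun _ => measurableSet_Ico) (pairwise_disjoint_Ico_nat_mul hh) f

theorem volume_Ico_nat_mul (h : ℝ) (j : ℕ) :
    volume (Ico (h * j) (h * ((j : ℝ) + 1))) = ENNReal.ofReal h := by
  rw [Real.volume_Ico]
  ring_nf

theorem setLIntegral_Ici_le_tsum {f : ℝ → ℝ≥0∞} (hf : Antitone f) {h : ℝ} (hh : 0 < h) :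
    ∫⁻ t in Ici (0 : ℝ), f t ≤ ∑' j : ℕ, f (h * j) * ENNReal.ofReal h := by
  rw [setLIntegral_Ici_eq_tsum hh]
  refine ENNReal.tsum_le_tsum fun j => ?_
  calc ∫⁻ t in Ico (h * j) (h * ((j : ℝ) + 1)), f t
      ≤ ∫⁻ _ in Ico (h * j) (h * ((j : ℝ) + 1)), f (h * j) :=
        setLIntegral_mono' measurableSet_Ico fun t ht => hf ht.1
    _ = f (h * j) * ENNReal.ofReal h := by rw [setLIntegral_const, volume_Ico_nat_mul]

theorem tsum_le_setLIntegral_Ici {f : ℝ → ℝ≥0∞} (hf : Antitone f) {h : ℝ} (hh : 0 < h) :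
    ∑' j : ℕ, f (h * ((j : ℝ) + 1)) * ENNReal.ofReal h ≤ ∫⁻ t in Ici (0 : ℝ), f t := by
  rw [setLIntegral_Ici_eq_tsum hh]
  refine ENNReal.tsum_le_tsum fun j => ?_
  calc f (h * ((j : ℝ) + 1)) * ENNReal.ofReal h
      = ∫⁻ _ in Ico (h * j) (h * ((j : ℝ) + 1)), f (h * ((j : ℝ) + 1)) := by
        rw [setLIntegral_const, volume_Ico_nat_mul]
    _ ≤ ∫⁻ t in Ico (h * j) (h * ((j : ℝ) + 1)), f t :=
        setLIntegral_mono' measurableSet_Ico fun t ht => hf ht.2.le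

/-- The integral of a decreasing function is the supremum of its lower Riemann sums. -/
theorem setLIntegral_Ici_eq_iSup {f : ℝ → ℝ≥0∞} (hf : Antitone f) (hf1 : f 0 ≠ ∞) :
    ∫⁻ t in Ici (0 : ℝ), f t = ⨆ k : ℕ,
      ∑' j : ℕ, f (1 / ((k : ℝ) + 1) * ((j : ℝ) + 1)) * ENNReal.ofReal (1 / ((k : ℝ) + 1)) := by
  refine le_antisymm ?_ (iSup_le fun k => tsum_le_setLIntegral_Ici hf (by positivity))
  -- Upper and lower sums of mesh `h` differ only by the first term `f 0 * h`, which vanishes with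
  -- `h`.
  have hlim : Tendsto (fun k : ℕ => (⨆ k : ℕ, ∑' j : ℕ, f (1 / ((k : ℝ) + 1) * ((j : ℝ) + 1)) *
      ENNReal.ofReal (1 / ((k : ℝ) + 1))) + f 0 * ENNReal.ofReal (1 / ((k : ℝ) + 1))) atTop
      (𝓝 ((⨆ k : ℕ, ∑' j : ℕ, f (1 / ((k : ℝ) + 1) * ((j : ℝ) + 1)) *
      ENNReal.ofReal (1 / ((k : ℝ) + 1))) + f 0 * ENNReal.ofReal 0)) :=
    (ENNReal.Tendsto.const_mul (ENNReal.tendsto_ofReal tendsto_one_div_add_atTop_nhds_zero_nat)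
      (Or.inr hf1)).const_add _
  rw [ENNReal.ofReal_zero, mul_zero, add_zero] at hlim
  refine ge_of_tendsto' hlim fun k => ?_
  refine (setLIntegral_Ici_le_tsum hf (h := 1 / ((k : ℝ) + 1)) (by positivity)).trans ?_
  rw [tsum_eq_zero_add' ENNReal.summable, add_comm]
  simp only [Nat.cast_zero, mul_zero, Nat.cast_add, Nat.cast_one]
  gcongr
  exact le_iSup (fun k : ℕ => ∑' j : ℕ, f (1 / ((k : ℝ) + 1) * ((j : ℝ) + 1)) *
      ENNReal.ofReal (1 / ((k : ℝ) + 1))) k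

namespace Subordinators

theorem antitone_exp_neg {Ω : Type*} {X : ℝ → Ω → ℝ≥0∞} {ω : Ω} (hX : Monotone fun t => X t ω) :
    Antitone fun t => EReal.exp (-(X t ω : EReal)) :=
  expNeg_antitone.comp_monotone hX

/-- Countably many times suffice in the Riemann sums, so no joint measurability in `(t, ω)` is
needed. -/
theorem measurable_expFunctional {Ω : Type*} [MeasurableSpace Ω] {X : ℝ → Ω → ℝ≥0∞} (hX : ∀ ω, Monotone fun t => X t ω)
    (hm : ∀ t, Measurable (X t)) : Measurable (expFunctional X) := by
  have : expFunctional X = fun ω => ⨆ k : ℕ, ∑' j : ℕ,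
      EReal.exp (-(X (1 / ((k : ℝ) + 1) * ((j : ℝ) + 1)) ω : EReal)) *
        ENNReal.ofReal (1 / ((k : ℝ) + 1)) := by
    ext ω
    exact setLIntegral_Ici_eq_iSup (antitone_exp_neg (hX ω))
      ((expNeg_le_one _).trans_lt ENNReal.one_lt_top).ne
  rw [this]
  refine Measurable.iSup fun k => Measurable.tsum fun j => ?_
  exact (continuous_expNeg.measurable.comp (hm _)).mul_const _

theorem expFunctional_le_tsum {Ω : Type*} {X : ℝ → Ω → ℝ≥0∞} {ω : Ω} (hX : Monotone fun t => X t ω) :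
    expFunctional X ω ≤ ∑' n : ℕ, EReal.exp (-(X n ω : EReal)) := by
  rw [expFunctional]
  simpa using setLIntegral_Ici_le_tsum (antitone_exp_neg hX) one_pos

theorem expFunctional_mono {Ω : Type*} {X Y : ℝ → Ω → ℝ≥0∞} {ω : Ω} (h : ∀ t, Y t ω ≤ X t ω) :
    expFunctional X ω ≤ expFunctional Y ω :=
  lintegral_mono fun t => expNeg_antitone (h t)

end Subordinators

/-- Weighted comparison of a power of a series with the series of powers. -/
theorem ENNReal.tsum_pow_le (a b : ℕ → ℝ≥0∞) (m : ℕ) :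
    (∑' n, b n * a n) ^ m ≤ (∑' n, a n ^ m) * (∑' n, b n) ^ m := by
  have h1 : ∑' n, b n * a n ≤ (⨆ n, a n) * ∑' n, b n := by
    rw [← ENNReal.tsum_mul_left]
    refine ENNReal.tsum_le_tsum fun n => ?_
    rw [mul_comm]
    gcongr
    exact le_iSup a n
  calc (∑' n, b n * a n) ^ m ≤ ((⨆ n, a n) * ∑' n, b n) ^ m := by gcongr
    _ = (⨆ n, a n ^ m) * (∑' n, b n) ^ m := by rw [mul_pow, ENNReal.iSup_pow]
    _ ≤ _ := by gcongr; exact iSup_le fun n => ENNReal.le_tsum n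

theorem lintegral_poissonMeasure_pow (r : ℝ≥0) {q : ℝ} (hq : 0 ≤ q) :
    ∫⁻ n : ℕ, ENNReal.ofReal q ^ n ∂(poissonMeasure r)
      = ENNReal.ofReal (Real.exp (-(r * (1 - q)))) := by
  rw [poissonMeasure, lintegral_sum_measure]
  have h := (NormedSpace.expSeries_div_hasSum_exp ((r : ℝ) * q)).mul_left (Real.exp (-r))
  rw [← Real.exp_eq_exp_ℝ, ← Real.exp_add] at h
  have he : -(r * (1 - q)) = -(r : ℝ) + r * q := by ring
  rw [he, ← h.tsum_eq, ENNReal.ofReal_tsum_of_nonneg (fun n => by positivity) h.summable]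
  refine tsum_congr fun n => ?_
  rw [lintegral_smul_measure, lintegral_dirac, smul_eq_mul, ← ENNReal.ofReal_pow hq,
    ← ENNReal.ofReal_mul (by positivity)]
  congr 1
  rw [mul_pow]
  ring

namespace Subordinators

/-! ### Finiteness and positivity of the Lévy measure away from zero. -/

section LevyMeasure

variable {ν : Measure ℝ}

theorem IsSubordinatorLevyMeasure.measure_Ici_lt_top (hν : IsSubordinatorLevyMeasure ν) {ε : ℝ}
    (hε : 0 < ε) : ν (Ici ε) < ∞ := by
  have hpos : ENNReal.ofReal (min 1 ε) ≠ 0 := by simp [hε]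
  refine lt_of_le_of_lt ((measure_mono fun z hz => ?_).trans
    (meas_ge_le_lintegral_div (f := fun z => ENNReal.ofReal (min 1 z)) (μ := ν) (by fun_prop)
      hpos ENNReal.ofReal_ne_top)) (ENNReal.div_lt_top hν.lintegral_min_lt_top.ne hpos)
  exact ENNReal.ofReal_le_ofReal (min_le_min_left 1 hz)

theorem iUnion_Ici_one_div : ⋃ n : ℕ, Ici (1 / ((n : ℝ) + 1)) = Ioi 0 := by
  ext x
  simp only [mem_iUnion, mem_Ici, mem_Ioi]
  refine ⟨fun ⟨n, hn⟩ => lt_of_lt_of_le (by positivity) hn, fun hx => ?_⟩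
  obtain ⟨n, hn⟩ := exists_nat_one_div_lt hx
  exact ⟨n, hn.le⟩

theorem IsSubordinatorLevyMeasure.sigmaFinite (hν : IsSubordinatorLevyMeasure ν) :
    SigmaFinite ν := by
  refine ⟨⟨⟨fun n : ℕ => Iic 0 ∪ Ici (1 / ((n : ℝ) + 1)), fun _ => trivial, fun n => ?_, ?_⟩⟩⟩
  · refine (measure_union_le _ _).trans_lt ?_
    rw [hν.measure_Iic_zero, zero_add]
    exact hν.measure_Ici_lt_top (by positivity)
  · rw [← union_iUnion, iUnion_Ici_one_div, Iic_union_Ioi]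

theorem IsSubordinatorLevyMeasure.exists_measure_Ici_pos (hν : IsSubordinatorLevyMeasure ν)
    (hν0 : ν ≠ 0) : ∃ ε : ℝ, 0 < ε ∧ ε ≤ 1 ∧ 0 < ν (Ici ε) := by
  have h : 0 < ν (⋃ n : ℕ, Ici (1 / ((n : ℝ) + 1))) := by
    rw [iUnion_Ici_one_div, pos_iff_ne_zero]
    intro h0
    refine hν0 (Measure.measure_univ_eq_zero.1 ?_)
    rw [← Iic_union_Ioi (a := (0 : ℝ))]
    exact measure_union_null hν.measure_Iic_zero h0
  obtain ⟨n, hn⟩ := exists_measure_pos_of_not_measure_iUnion_null h.ne'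
  exact ⟨1 / ((n : ℝ) + 1), by positivity, by
    rw [div_le_one (by positivity)]; linarith [n.cast_nonneg (α := ℝ)], hn⟩

theorem IsSubordinatorLevyMeasure.jumpIntensity_apply (hν : IsSubordinatorLevyMeasure ν)
    (t : ℝ) (B : Set ℝ) :
    jumpIntensity ν (Icc 0 t ×ˢ B) = ENNReal.ofReal t * ν B := by
  have := hν.sigmaFinite
  rw [jumpIntensity, Measure.prod_prod, Measure.restrict_apply measurableSet_Icc,
    inter_eq_left.2 Icc_subset_Ici_self, Real.volume_Icc, sub_zero]

end LevyMeasure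

/-! ### Comparison and convergence of the jump processes. -/

section Jumps

variable {Ω : Type*} {M : Ω → Measure (ℝ × ℝ)}

theorem monotone_approxProcess (M : Ω → Measure (ℝ × ℝ)) (ε : ℝ) (ω : Ω) :
    Monotone fun t => approxProcess M ε t ω := fun _ _ h =>
  lintegral_mono_set (prod_mono_left (Icc_subset_Icc_right h))

theorem measurable_approxProcess [MeasurableSpace Ω] (hM : Measurable M) (ε t : ℝ) :
    Measurable (approxProcess M ε t) := by
  have h : MeasurableSet (Icc 0 t ×ˢ Ici ε) := measurableSet_Icc.prod measurableSet_Ici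
  unfold approxProcess
  simp_rw [← lintegral_indicator h]
  exact (Measure.measurable_lintegral (Measurable.indicator (by fun_prop) h)).comp hM

theorem mul_floor_div_le {ε : ℝ} (hε : 0 < ε) (z : ℝ) : ε * (⌊z / ε⌋ : ℝ) ≤ z := by
  rw [mul_comm, ← le_div_iff₀ hε]
  exact Int.floor_le _

theorem sub_lt_mul_floor_div {ε : ℝ} (hε : 0 < ε) (z : ℝ) : z - ε < ε * (⌊z / ε⌋ : ℝ) := by
  have h : z / ε < ⌊z / ε⌋ + 1 := Int.lt_floor_add_one _
  rw [div_lt_iff₀ hε] at h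
  linarith

/-- The rounded value is at least `ε`, while the rounding loses less than `ε`. The factor `1/2` does
not depend on `ε`. -/
theorem half_le_mul_floor_div {ε z : ℝ} (hε : 0 < ε) (hz : ε ≤ z) :
    z / 2 ≤ ε * (⌊z / ε⌋ : ℝ) := by
  have h1 : (1 : ℝ) ≤ ⌊z / ε⌋ := by
    exact_mod_cast Int.le_floor.2 (by simpa using (one_le_div hε).2 hz)
  nlinarith [sub_lt_mul_floor_div hε z]

theorem approxProcess_le_jumpProcess {ε : ℝ} (hε : 0 < ε) (t : ℝ) (ω : Ω) :
    approxProcess M ε t ω ≤ jumpProcess M t ω :=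
  (lintegral_mono fun _ => ENNReal.ofReal_le_ofReal (mul_floor_div_le hε _)).trans
    (lintegral_mono_set (prod_mono_right fun _ hz => hε.trans_le hz))

theorem mul_measure_le_approxProcess {ε ε₀ : ℝ} (hε : 0 < ε) (h : ε ≤ ε₀) (t : ℝ) (ω : Ω) :
    ENNReal.ofReal (ε₀ / 2) * M ω (Icc 0 t ×ˢ Ici ε₀) ≤ approxProcess M ε t ω := by
  rw [← setLIntegral_const]
  refine (setLIntegral_mono' (measurableSet_Icc.prod measurableSet_Ici) fun p hp => ?_).trans
    (lintegral_mono_set (prod_mono_right (Ici_subset_Ici.2 h)))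
  have hp2 : ε₀ ≤ p.2 := hp.2
  exact ENNReal.ofReal_le_ofReal
    (le_trans (by linarith) (half_le_mul_floor_div hε (h.trans hp2)))

/-- The floor vanishes on `(0, ε)`. This makes the domain independent of `ε`, as Fatou's lemma
requires. -/
theorem approxProcess_eq {ε : ℝ} (hε : 0 < ε) (t : ℝ) (ω : Ω) :
    approxProcess M ε t ω =
      ∫⁻ p in Icc 0 t ×ˢ Ioi 0, ENNReal.ofReal (ε * (⌊p.2 / ε⌋ : ℝ)) ∂(M ω) := by
  refine le_antisymm (lintegral_mono_set (prod_mono_right fun _ hz => hε.trans_le hz)) ?_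
  rw [approxProcess, ← lintegral_indicator (measurableSet_Icc.prod measurableSet_Ioi),
    ← lintegral_indicator (measurableSet_Icc.prod measurableSet_Ici)]
  refine lintegral_mono fun p => indicator_le' (fun p hp => ?_) (fun _ _ => zero_le) p
  by_cases hz : ε ≤ p.2
  · rw [indicator_of_mem (show p ∈ Icc 0 t ×ˢ Ici ε from ⟨hp.1, hz⟩)]
  · have h0 : (0 : ℝ) < p.2 := hp.2
    have : ⌊p.2 / ε⌋ = 0 := Int.floor_eq_zero_iff.2
      ⟨by positivity, (div_lt_one hε).2 (not_le.1 hz)⟩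
    simp [this]

theorem tendsto_ratCast_nhdsGT_zero : Tendsto (fun ε : ℚ => (ε : ℝ)) (𝓝[>] 0) (𝓝 0) := by
  have := (Rat.continuous_coe_real.tendsto (0 : ℚ)).mono_left (nhdsWithin_le_nhds (s := Ioi 0))
  simpa using this

theorem tendsto_mul_floor_div (z : ℝ) :
    Tendsto (fun ε : ℚ => (ε : ℝ) * (⌊z / (ε : ℝ)⌋ : ℝ)) (𝓝[>] 0) (𝓝 z) := by
  have h0 : Tendsto (fun ε : ℚ => z - (ε : ℝ)) (𝓝[>] 0) (𝓝 z) := by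
    simpa using tendsto_ratCast_nhdsGT_zero.const_sub z
  refine tendsto_of_tendsto_of_tendsto_of_le_of_le' h0 tendsto_const_nhds ?_ ?_ <;>
    filter_upwards [self_mem_nhdsWithin] with ε hε
  · exact (sub_lt_mul_floor_div (Rat.cast_pos.2 hε) z).le
  · exact mul_floor_div_le (Rat.cast_pos.2 hε) z

/-- Fatou bounds the liminf below and `approxProcess_le_jumpProcess` bounds the limsup above; this
also covers an infinite limit. -/
theorem tendsto_approxProcess (M : Ω → Measure (ℝ × ℝ)) (t : ℝ) (ω : Ω) :
    Tendsto (fun ε : ℚ => approxProcess M (ε : ℝ) t ω) (𝓝[>] 0) (𝓝 (jumpProcess M t ω)) := by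
  refine tendsto_of_le_liminf_of_limsup_le ?_ ?_
  · have hF := lintegral_liminf_le (μ := (M ω).restrict (Icc 0 t ×ˢ Ioi 0)) (u := 𝓝[>] (0 : ℚ))
      (f := fun (ε : ℚ) (p : ℝ × ℝ) => ENNReal.ofReal ((ε : ℝ) * (⌊p.2 / (ε : ℝ)⌋ : ℝ)))
      (fun ε => by fun_prop)
    calc jumpProcess M t ω = _ := by
          refine lintegral_congr fun p => ?_
          exact (ENNReal.tendsto_ofReal (tendsto_mul_floor_div p.2)).liminf_eq.symm
      _ ≤ _ := hF
      _ = _ := by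
          refine liminf_congr ?_
          filter_upwards [self_mem_nhdsWithin] with ε hε
          exact (approxProcess_eq (Rat.cast_pos.2 hε) t ω).symm
  · refine limsup_le_of_le (by isBoundedDefault) ?_
    filter_upwards [self_mem_nhdsWithin] with ε hε
    exact approxProcess_le_jumpProcess (Rat.cast_pos.2 hε) t ω

end Jumps

/-! ### Poisson Laplace transform and moments of the dominating series. -/

section Moments

variable {Ω E : Type*} [MeasurableSpace Ω] [MeasurableSpace E] {P : Measure Ω}

theorem IsPoissonRandomMeasure.lintegral_exp_neg_pow {M : Ω → Measure E} {μ : Measure E}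
    (hM : IsPoissonRandomMeasure M μ P) {B : Set E} (hB : MeasurableSet B) (hμ : μ B ≠ ∞)
    {c : ℝ} (hc : 0 ≤ c) (m : ℕ) :
    ∫⁻ ω, EReal.exp (-((ENNReal.ofReal c * M ω B : ℝ≥0∞) : EReal)) ^ m ∂P =
      ENNReal.ofReal (Real.exp (-((μ B).toReal * (1 - Real.exp (-(c * m)))))) := by
  have hg : Measurable fun x : ℝ≥0∞ =>
      EReal.exp (-((ENNReal.ofReal c * x : ℝ≥0∞) : EReal)) ^ m :=
    (continuous_expNeg.measurable.comp (measurable_id.const_mul _)).pow_const m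
  have hMB : Measurable fun ω => M ω B := (Measure.measurable_coe hB).comp hM.measurable
  rw [← lintegral_map hg hMB, hM.map_apply B hB hμ, lintegral_map hg .of_discrete]
  refine Eq.trans (lintegral_congr fun n => ?_)
    (lintegral_poissonMeasure_pow (μ B).toNNReal (Real.exp_pos (-(c * m))).le)
  rw [← ENNReal.ofReal_natCast, ← ENNReal.ofReal_mul hc, expNeg_ofReal (by positivity),
    ← ENNReal.ofReal_pow (by positivity), ← ENNReal.ofReal_pow (by positivity),
    ← Real.exp_nat_mul, ← Real.exp_nat_mul]
  ring_nf

theorem tsum_ofReal_exp_neg_lt_top {a : ℝ} (ha : 0 < a) :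
    ∑' n : ℕ, ENNReal.ofReal (Real.exp (-(a * n))) < ∞ := by
  have h : ∀ n : ℕ, ENNReal.ofReal (Real.exp (-(a * n))) = ENNReal.ofReal (Real.exp (-a)) ^ n := by
    intro n
    rw [← ENNReal.ofReal_pow (by positivity), ← Real.exp_nat_mul]
    ring_nf
  simp_rw [h]
  rw [ENNReal.tsum_geometric, ENNReal.inv_lt_top, tsub_pos_iff_lt]
  simpa using ha

/-- All moments of the series `∑ₙ e^{-c Nₙ}` are finite, where `Nₙ` counts the jumps of size at
least `ε` up to time `n`. -/
theorem lintegral_tsum_exp_neg_pow_lt_top [IsProbabilityMeasure P] {ν : Measure ℝ}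
    (hν : IsSubordinatorLevyMeasure ν) {M : Ω → Measure (ℝ × ℝ)}
    (hM : IsPoissonRandomMeasure M (jumpIntensity ν) P) {ε : ℝ} (hε : 0 < ε)
    (hpos : 0 < ν (Ici ε)) {c : ℝ} (hc : 0 < c) (m : ℕ) :
    ∫⁻ ω, (∑' n : ℕ, EReal.exp
      (-((ENNReal.ofReal c * M ω (Icc 0 (n : ℝ) ×ˢ Ici ε) : ℝ≥0∞) : EReal))) ^ m ∂P < ∞ := by
  rcases Nat.eq_zero_or_pos m with rfl | hm
  · simp
  have hm' : (0 : ℝ) < m := by exact_mod_cast hm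
  have hB : ∀ n : ℕ, MeasurableSet (Icc 0 (n : ℝ) ×ˢ Ici ε) := fun n =>
    measurableSet_Icc.prod measurableSet_Ici
  have hνt := hν.measure_Ici_lt_top hε
  set l : ℝ := (ν (Ici ε)).toReal with hl
  have hlpos : 0 < l := ENNReal.toReal_pos hpos.ne' hνt.ne
  have hk : 0 < l * (1 - Real.exp (-(c * m))) :=
    mul_pos hlpos (sub_pos.2 (by simpa using mul_pos hc hm'))
  set k : ℝ := l * (1 - Real.exp (-(c * m))) with hkdef
  -- Weights `e^{rn}` cost `e^{rnm} = e^{kn/2}` after the `m`-th power, half of the available decay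
  -- `e^{-kn}`.
  set r : ℝ := k / (2 * m) with hr
  have hrpos : 0 < r := by positivity
  have hmeas : ∀ n : ℕ, Measurable fun ω =>
      EReal.exp (-((ENNReal.ofReal c * M ω (Icc 0 (n : ℝ) ×ˢ Ici ε) : ℝ≥0∞) : EReal)) := fun n =>
    continuous_expNeg.measurable.comp
      (((Measure.measurable_coe (hB n)).comp hM.measurable).const_mul _)
  have hlap : ∀ n : ℕ, ∫⁻ ω, EReal.exp
      (-((ENNReal.ofReal c * M ω (Icc 0 (n : ℝ) ×ˢ Ici ε) : ℝ≥0∞) : EReal)) ^ m ∂P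
        = ENNReal.ofReal (Real.exp (-(k * n))) := by
    intro n
    have hμ := hν.jumpIntensity_apply n (Ici ε)
    rw [hM.lintegral_exp_neg_pow (hB n) (by rw [hμ]; finiteness) hc.le, hμ,
      ENNReal.toReal_mul, ENNReal.toReal_ofReal n.cast_nonneg, ← hl, hkdef]
    ring_nf
  have hbound : ∀ ω, (∑' n : ℕ, EReal.exp
      (-((ENNReal.ofReal c * M ω (Icc 0 (n : ℝ) ×ˢ Ici ε) : ℝ≥0∞) : EReal))) ^ m ≤
      (∑' n : ℕ, ENNReal.ofReal (Real.exp (r * n * m)) * EReal.exp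
        (-((ENNReal.ofReal c * M ω (Icc 0 (n : ℝ) ×ˢ Ici ε) : ℝ≥0∞) : EReal)) ^ m) *
      (∑' n : ℕ, ENNReal.ofReal (Real.exp (-(r * n)))) ^ m := by
    intro ω
    have h := ENNReal.tsum_pow_le (fun n : ℕ => ENNReal.ofReal (Real.exp (r * n)) * EReal.exp
      (-((ENNReal.ofReal c * M ω (Icc 0 (n : ℝ) ×ˢ Ici ε) : ℝ≥0∞) : EReal)))
      (fun n : ℕ => ENNReal.ofReal (Real.exp (-(r * n)))) m
    refine (le_of_eq ?_).trans (h.trans (le_of_eq ?_))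
    · congr 1
      refine tsum_congr fun n => ?_
      rw [← mul_assoc, ← ENNReal.ofReal_mul (by positivity), ← Real.exp_add]
      simp
    · congr 1
      refine tsum_congr fun n => ?_
      rw [mul_pow, ← ENNReal.ofReal_pow (by positivity), ← Real.exp_nat_mul]
      ring_nf
  refine (lintegral_mono hbound).trans_lt ?_
  rw [lintegral_mul_const' _ _ (ENNReal.pow_ne_top (tsum_ofReal_exp_neg_lt_top hrpos).ne),
    lintegral_tsum fun n => (((hmeas n).pow_const m).const_mul _).aemeasurable]
  refine ENNReal.mul_lt_top ?_ (ENNReal.pow_lt_top (tsum_ofReal_exp_neg_lt_top hrpos))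
  refine lt_of_eq_of_lt (tsum_congr fun n => ?_)
    (tsum_ofReal_exp_neg_lt_top (a := k / 2) (by positivity))
  rw [lintegral_const_mul' _ _ ENNReal.ofReal_ne_top, hlap, ← ENNReal.ofReal_mul (by positivity),
    ← Real.exp_add, hr]
  congr 2
  field_simp
  ring

end Moments

end Subordinators

/-- A single `L^p` function is uniformly integrable, and its `δ` serves every function it dominates.
-/
theorem MeasureTheory.uniformIntegrable_of_norm_le {α β ι : Type*} [MeasurableSpace α]
    [NormedAddCommGroup β] {μ : Measure α} {p : ℝ≥0∞} (hp : 1 ≤ p) (hp' : p ≠ ∞)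
    {f : ι → α → β} {g : α → ℝ} (hf : ∀ i, AEStronglyMeasurable (f i) μ) (hg : MemLp g p μ)
    (h : ∀ i, ∀ᵐ a ∂μ, ‖f i a‖ ≤ g a) : UniformIntegrable f p μ := by
  refine ⟨hf, fun η hη => ?_, (eLpNorm g p μ).toNNReal, fun i => ?_⟩
  · obtain ⟨δ, hδ, H⟩ := unifIntegrable_const (ι := Unit) hp hp' hg hη
    refine ⟨δ, hδ, fun i s hs hμs => le_trans (eLpNorm_mono_ae_real ?_) (H () s hs hμs)⟩
    filter_upwards [h i] with a ha
    by_cases has : a ∈ s <;> simp [has, ha]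
  · rw [ENNReal.coe_toNNReal hg.2.ne]
    exact eLpNorm_mono_ae_real (h i)

theorem mainTheorem11 {Ω : Type*} [MeasurableSpace Ω] (P : Measure Ω) [IsProbabilityMeasure P]
    (ν : Measure ℝ) (hν : Subordinators.IsSubordinatorLevyMeasure ν) (hν0 : ν ≠ 0)
    (M : Ω → Measure (ℝ × ℝ))
    (hM : Subordinators.IsPoissonRandomMeasure M (Subordinators.jumpIntensity ν) P)
    (m : ℕ) :
    (∀ ε₀ : ℝ, 0 < ε₀ → ε₀ ≤ 1 → 0 < ν (Ici ε₀) →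
      (∀ ε : ℚ, 0 < ε → (ε : ℝ) ≤ ε₀ →
        ∀ᵐ ω ∂P, Subordinators.expFunctional (Subordinators.approxProcess M (ε : ℝ)) ω < ∞) ∧
      UniformIntegrable
        (fun (ε : {ε : ℚ // 0 < ε ∧ (ε : ℝ) ≤ ε₀}) (ω : Ω) =>
          (Subordinators.expFunctional
            (Subordinators.approxProcess M ((ε : ℚ) : ℝ)) ω).toReal ^ m) 1 P) ∧
    (∫⁻ ω, Subordinators.expFunctional (Subordinators.jumpProcess M) ω ^ m ∂P) < ∞ ∧
    Tendsto
      (fun ε : ℚ =>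
        ∫⁻ ω, Subordinators.expFunctional (Subordinators.approxProcess M (ε : ℝ)) ω ^ m ∂P)
      (𝓝[>] 0)
      (𝓝 (∫⁻ ω, Subordinators.expFunctional (Subordinators.jumpProcess M) ω ^ m ∂P)) := by
  open Subordinators in
  let Y : ℝ → ℝ → Ω → ℝ≥0∞ := fun ε₀ t ω =>
    ENNReal.ofReal (ε₀ / 2) * M ω (Icc 0 t ×ˢ Ici ε₀)
  have hYmono : ∀ ε₀ ω, Monotone fun t => Y ε₀ t ω := fun ε₀ ω s t h => by
    dsimp only [Y]
    gcongr
  have hYmeas : ∀ ε₀ t, Measurable (Y ε₀ t) := fun ε₀ t =>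
    ((Measure.measurable_coe (measurableSet_Icc.prod measurableSet_Ici)).comp
      hM.measurable).const_mul _
  have hYm : ∀ ε₀, Measurable (expFunctional (Y ε₀)) := fun ε₀ =>
    measurable_expFunctional (hYmono ε₀) (hYmeas ε₀)
  have hYint : ∀ ε₀, 0 < ε₀ → 0 < ν (Ici ε₀) → ∀ k : ℕ,
      ∫⁻ ω, expFunctional (Y ε₀) ω ^ k ∂P < ∞ := fun ε₀ h0 hpos k =>
    (lintegral_mono fun ω => pow_le_pow_left' (expFunctional_le_tsum (hYmono ε₀ ω)) k).trans_lt
      (lintegral_tsum_exp_neg_pow_lt_top hν hM h0 hpos (half_pos h0) k)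
  have hYfin : ∀ ε₀, 0 < ε₀ → 0 < ν (Ici ε₀) → ∀ᵐ ω ∂P, expFunctional (Y ε₀) ω < ∞ :=
    fun ε₀ h0 hpos => ae_lt_top (hYm ε₀) (by simpa using (hYint ε₀ h0 hpos 1).ne)
  have hle : ∀ ε₀ ε : ℝ, 0 < ε → ε ≤ ε₀ → ∀ ω,
      expFunctional (approxProcess M ε) ω ≤ expFunctional (Y ε₀) ω := fun ε₀ ε hε h ω =>
    expFunctional_mono fun t => mul_measure_le_approxProcess hε h t ω
  have hAm : ∀ ε, Measurable (expFunctional (approxProcess M ε)) := fun ε =>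
    measurable_expFunctional (monotone_approxProcess M ε) (measurable_approxProcess hM.measurable ε)
  refine ⟨fun ε₀ h0 _ hpos => ⟨fun ε hε hεle => ?_, ?_⟩, ?_⟩
  · filter_upwards [hYfin ε₀ h0 hpos] with ω hω
    exact (hle ε₀ ε (Rat.cast_pos.2 hε) hεle ω).trans_lt hω
  · refine uniformIntegrable_of_norm_le (g := fun ω => (expFunctional (Y ε₀) ω ^ m).toReal) le_rfl
      ENNReal.one_ne_top (fun ε => ((hAm _).ennreal_toReal.pow_const m).aestronglyMeasurable) ?_
      fun ε => ?_
    · exact memLp_one_iff_integrable.2 (integrable_toReal_of_lintegral_ne_top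
        ((hYm ε₀).pow_const m).aemeasurable (hYint ε₀ h0 hpos m).ne)
    · filter_upwards [hYfin ε₀ h0 hpos] with ω hω
      rw [Real.norm_of_nonneg (by positivity), ENNReal.toReal_pow]
      gcongr
      -- `toReal` sends `∞` to `0`, so it is monotone only below a finite bound.
      · exact hω.ne
      · exact hle ε₀ ε (Rat.cast_pos.2 ε.2.1) ε.2.2 ω
  · obtain ⟨ε₀, h0, -, hpos⟩ := hν.exists_measure_Ici_pos hν0
    have hsmall : ∀ᶠ ε : ℚ in 𝓝[>] 0, 0 < (ε : ℝ) ∧ (ε : ℝ) ≤ ε₀ := by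
      filter_upwards [self_mem_nhdsWithin, tendsto_ratCast_nhdsGT_zero.eventually (Iic_mem_nhds h0)]
        with ε hε hε' using ⟨Rat.cast_pos.2 hε, hε'⟩
    refine ⟨?_, ?_⟩
    · refine (lintegral_mono fun ω => pow_le_pow_left' ?_ m).trans_lt (hYint ε₀ h0 hpos m)
      -- The limit process is compared with `Y` through the approximation at `ε = ε₀`.
      exact expFunctional_mono fun t => (mul_measure_le_approxProcess h0 le_rfl t ω).trans
        (approxProcess_le_jumpProcess h0 t ω)
    · refine tendsto_lintegral_filter_of_dominated_convergence
        (fun ω => expFunctional (Y ε₀) ω ^ m) (.of_forall fun ε => (hAm _).pow_const m) ?_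
        (hYint ε₀ h0 hpos m).ne ?_
      · filter_upwards [hsmall] with ε hε
        exact .of_forall fun ω => pow_le_pow_left' (hle ε₀ ε hε.1 hε.2 ω) m
      · filter_upwards [hYfin ε₀ h0 hpos] with ω hω
        refine ((ENNReal.continuous_pow m).tendsto _).comp ?_
        -- For fixed `ω`, `e^{-Y_t}` dominates in `t`; its integral is finite by `hω`.
        refine tendsto_lintegral_filter_of_dominated_convergence
          (fun t => EReal.exp (-(Y ε₀ t ω : EReal)))
          (.of_forall fun ε => (antitone_exp_neg (monotone_approxProcess M ε ω)).measurable) ?_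
          hω.ne (.of_forall fun t => (continuous_expNeg.tendsto _).comp (tendsto_approxProcess M t ω))
        filter_upwards [hsmall] with ε hε
        exact .of_forall fun t => expNeg_antitone (mul_measure_le_approxProcess hε.1 hε.2 t ω)
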